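/- Let $n,p,m\ge 1$, let $X\in\mathbb R^{n\times p}$ be a fixed design and $Y$ a random $n\times m$ matrix. Let $l_0(\eta;Y)$ be a real-valued loss, differentiable in $\eta\in\mathbb R^{n\times m}$, and let $B^*\in\mathbb R^{p\times m}$. Suppose that the effective noise $E=-\nabla l_0(XB^*;Y)$ has mean zero and is sub-Gaussian with scale bounded by $\sigma\ge 0$, i.e. $\|\langle E,\alpha\rangle\|_{\psi_2}\le\sigma\|\alpha\|_F$ for all $\alpha\in\mathbb R^{n\times m}$, where $\|Z\|_{\psi_2}=\inf\{t>0:\mathbb E\exp(Z^2/t^2)\le 2\}$. For $B\in\mathbb R^{p\times m}$ with rows $b_1,\dots,b_p$, let $q(B)$ be the number of distinct rows, let $g_1,\dots,g_{q(B)}$ be the sizes of the groups of equal rows, and put $\mathcal C(B)=\frac12\sum_{i=1}^{q(B)}g_i(p-g_i)$, which is the number of pairs $j<j'$ with $b_j\ne b_{j'}$. Let $\Delta_{l_0}(\alpha,\beta)=l_0(\alpha;Y)-l_0(\beta;Y)-\langle\nabla l_0(\beta;Y),\alpha-\beta\rangle$, $\mathbf D_2(\alpha,\beta)=\|\alpha-\beta\|_F^2/2$,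 and $\lambda_o=\sigma\sqrt{(p\vee m)/p}$. Assume that for some (non-random) $\delta>0$, $K\ge0$, almost surely, $$\Delta_{l_0}(XB_1,XB_2)+K\lambda_o^2\,\mathcal C(B_1)+K\lambda_o^2\,\mathcal C(B_2)\ \ge\ \delta\,\mathbf D_2(XB_1,XB_2)\qquad\text{for all }B_1,B_2\in\mathbb R^{p\times m}.$$ Let $\lambda=A\sqrt{K\vee(1/\delta)}\,\lambda_o$ and let $\hat B$ be an optimal solution of $$\min_{B\in\mathbb R^{p\times m}}\ l_0(XB;Y)+\frac{\lambda^2}{2}\sum_{1\le j<j'\le p}1_{b_j\neq b_{j'}}.$$ There is a universal constant $A_0>0$ such that for every $A\ge A_0$ there is a constant $c>0$, depending only on $A$, such that in every such situation, with $q^*=q(B^*)$ and $r^*=\operatorname{rank}(B^*)$, $$\mathbb E\|X\hat B-XB^*\|_F^2\ \le\ c\,\frac{(K\delta\vee1)\sigma^2}{\delta^2}\Big\{m+\frac{m\vee p}{p}\,\mathcal C(B^*)\Big\},$$ $$\frac{(K\delta\vee1)\sigma^2}{\delta^2}\Big\{m+\frac{m\vee p}{p}\,\mathcal C(B^*)\Big\}\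 \le\ \frac{(K\delta\vee1)\sigma^2}{\delta^2}\Big\{m+(m\vee p)\Big(p-\frac{p}{q^*}\Big)\Big\}.$$ Moreover, the first rate is, up to the constant, never smaller than the corresponding rate of clustered reduced-rank learning (CRL) at $q=q^*$, $r=r^*$: $$\frac{(K\delta\vee1)\sigma^2}{\delta^2}\big\{(q^*\wedge\operatorname{rank}X+m)\,r^*+(p-q^*)\log q^*+1\big\}\ \le\ c\,\frac{(K\delta\vee1)\sigma^2}{\delta^2}\Big\{m+\frac{m\vee p}{p}\,\mathcal C(B^*)\Big\}.$$ -/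

import Mathlib

open MeasureTheory
open scoped ENNReal NNReal

attribute [local instance] Matrix.frobeniusNormedAddCommGroup
attribute [local instance] Matrix.frobeniusNormedSpace

noncomputable section

namespace PairwiseL0

/-- The inner product `⟨A, B⟩ = ∑ᵢⱼ Aᵢⱼ Bᵢⱼ` of matrices. -/
def frobInner {n m : ℕ} (A B : Matrix (Fin n) (Fin m) ℝ) : ℝ :=
  ∑ i, ∑ j, A i j * B i j

/-- The gradient matrix of `ψ` at `η`: the matrix of its partial derivatives. -/
def matGrad {n m : ℕ} (ψ : Matrix (Fin n) (Fin m) ℝ → ℝ) (η : Matrix (Fin n) (Fin m) ℝ) :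
    Matrix (Fin n) (Fin m) ℝ :=
  Matrix.of fun i j => fderiv ℝ ψ η (Matrix.single i j 1)

/-- The generalized Bregman function
`Δ_ψ(α, β) = ψ(α) - ψ(β) - ⟨∇ψ(β), α - β⟩`. -/
def bregman {n m : ℕ} (ψ : Matrix (Fin n) (Fin m) ℝ → ℝ)
    (α β : Matrix (Fin n) (Fin m) ℝ) : ℝ :=
  ψ α - ψ β - frobInner (matGrad ψ β) (α - β)

/-- `D₂(α, β) = ‖α - β‖_F² / 2`; the norm is the Frobenius norm. -/
def D2 {n m : ℕ} (α β : Matrix (Fin n) (Fin m) ℝ) : ℝ :=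
  ‖α - β‖ ^ 2 / 2

/-- The Orlicz norm `inf {t > 0 : 𝔼 exp((Z/t)²) ≤ 2}`, with value `∞` if there is no such `t`. -/
def psi2Norm {Ω : Type*} [MeasurableSpace Ω] (μ : Measure Ω) (Z : Ω → ℝ) : ℝ≥0∞ :=
  ⨅ (t : ℝ≥0) (_ : 0 < t ∧ ∫⁻ ω, ENNReal.ofReal (Real.exp ((Z ω / t) ^ 2)) ∂μ ≤ 2), (t : ℝ≥0∞)

/-- `vec(E)` is a sub-Gaussian random vector with mean zero and scale bounded by `σ`. -/
structure IsSubGaussianNoise {Ω : Type*} [MeasurableSpace Ω] (μ : Measure Ω) {n m : ℕ}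
    (E : Ω → Matrix (Fin n) (Fin m) ℝ) (σ : ℝ) : Prop where
  aemeasurable : ∀ i j, AEMeasurable (fun ω => E ω i j) μ
  mean_zero : ∀ i j, ∫ ω, E ω i j ∂μ = 0
  psi2_le : ∀ α : Matrix (Fin n) (Fin m) ℝ,
    psi2Norm μ (fun ω => frobInner (E ω) α) ≤ ENNReal.ofReal (σ * ‖α‖)

/-- The set of distinct rows of `B`; they label the row groups. -/
def distinctRows {p m : ℕ} (B : Matrix (Fin p) (Fin m) ℝ) : Finset (Fin m → ℝ) :=
  Finset.univ.image fun j => B.row j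

/-- The number `q(B)` of distinct rows of `B`. -/
def numGroups {p m : ℕ} (B : Matrix (Fin p) (Fin m) ℝ) : ℕ :=
  (distinctRows B).card

/-- The size of the group of rows of `B` that are equal to `v`. -/
def groupSize {p m : ℕ} (B : Matrix (Fin p) (Fin m) ℝ) (v : Fin m → ℝ) : ℕ :=
  (Finset.univ.filter fun j => B.row j = v).card

/-- `𝒞(B) = (1/2) ∑ᵢ gᵢ (p - gᵢ)`, the sum being over the groups of equal rows of `B`. -/
def clusterPen {p m : ℕ} (B : Matrix (Fin p) (Fin m) ℝ) : ℝ :=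
  (1 / 2) * ∑ v ∈ distinctRows B, (groupSize B v : ℝ) * ((p : ℝ) - groupSize B v)

/-- The `ℓ₀` penalty on pairwise row differences, `∑_{j < j'} 1_{b_j ≠ b_{j'}}`. -/
def pairwisePen {p m : ℕ} (B : Matrix (Fin p) (Fin m) ℝ) : ℝ :=
  ∑ j : Fin p, ∑ j' : Fin p, if j < j' ∧ B.row j ≠ B.row j' then 1 else 0

/-- The criterion `l₀(XB) + (λ²/2) ∑_{j < j'} 1_{b_j ≠ b_{j'}}`. -/
def pairwiseObjective {n p m : ℕ} (l : Matrix (Fin n) (Fin m) ℝ → ℝ)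
    (X : Matrix (Fin n) (Fin p) ℝ) (lam : ℝ) (B : Matrix (Fin p) (Fin m) ℝ) : ℝ :=
  l (X * B) + lam ^ 2 / 2 * pairwisePen B

/-- `λ_o = σ √((p ∨ m) / p)`. -/
def lambdaO (σ : ℝ) (p m : ℕ) : ℝ :=
  σ * Real.sqrt (max (p : ℝ) m / p)

/-- The complexity `P_o = {q ∧ rank(X) + m} r + (p - q) log q` of clustered reduced-rank learning
at `q = q(B)`, `r = rank(B)`. -/
def crlComplexity {n p m : ℕ} (X : Matrix (Fin n) (Fin p) ℝ) (B : Matrix (Fin p) (Fin m) ℝ) : ℝ :=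
  (min (numGroups B : ℝ) X.rank + m) * B.rank
    + ((p : ℝ) - numGroups B) * Real.log (numGroups B)

end PairwiseL0

end

/-!
Optimality of the estimator and the curvature condition give, with `D = X Bhat - X B*` and up to
the penalties of `Bhat` and `B*`, the basic inequality `δ/2 ‖D‖² ≤ ⟨E, D⟩`. If `Bhat` has `q`
distinct rows, then `D` lies in one of the `q ^ p` subspaces given by the labellings of the rows,
each of dimension at most `qm + 1`. Replacing an exponential of a square by an average over
Gaussian linear forms bounds the exponential moments of the projection of `E` on a fixed subspace,
and a union bound with weights `p (q - 1) + q + 1 ≥ log (q ^ p) + q + 1` then gives `⟨E, D⟩² ≲ σ²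
(qm + p (q - 1) + Z) ‖D‖²` simultaneously for all labellings, with `𝔼 Z ≤ 2`. The minimal penalty
of a matrix with `q` distinct rows is attained with `q - 1` singletons, so that `(m ∨ p) (q - 1) ≤
2 ((m ∨ p) / p) 𝒞(Bhat)`: for `A` large the penalty absorbs the noise.
-/

noncomputable section

namespace PairwiseL0

section StandardGaussian

open ProbabilityTheory
open scoped RealInnerProductSpace

theorem integral_exp_sq_div_four_gaussianReal :
    ∫ x, Real.exp (x ^ 2 / 4) ∂(gaussianReal 0 1) = √2 := by
  rw [integral_gaussianReal_eq_integral_smul one_ne_zero]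
  have hdensity : ∀ x : ℝ, gaussianPDFReal 0 1 x • Real.exp (x ^ 2 / 4)
      = (√(2 * Real.pi))⁻¹ * Real.exp (-(1 / 4) * x ^ 2) := fun x => by
    simp only [gaussianPDFReal, smul_eq_mul, mul_assoc, ← Real.exp_add, NNReal.coe_one, sub_zero,
      mul_one]
    ring_nf
  simp_rw [hdensity]
  rw [integral_const_mul, integral_gaussian, ← Real.sqrt_inv, ← Real.sqrt_mul (by positivity)]
  congr 1
  field_simp
  norm_num

variable {E : Type*} [NormedAddCommGroup E] [InnerProductSpace ℝ E] [FiniteDimensional ℝ E]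
  [MeasurableSpace E] [BorelSpace E]

theorem lintegral_exp_inner_stdGaussian (x : E) :
    ∫⁻ g, ENNReal.ofReal (Real.exp ⟪x, g⟫) ∂(stdGaussian E)
      = ENNReal.ofReal (Real.exp (‖x‖ ^ 2 / 2)) := by
  have hmap : (stdGaussian E).map (innerSL ℝ x) = gaussianReal 0 (‖x‖ ^ 2).toNNReal := by
    rw [IsGaussian.map_eq_gaussianReal, integral_strongDual_stdGaussian,
      variance_dual_stdGaussian, innerSL_apply_norm]
  have hmgf := mgf_gaussianReal hmap 1
  simp only [mgf, innerSL_apply_apply, one_mul, mul_one, zero_add, one_pow,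
    Real.coe_toNNReal _ (sq_nonneg ‖x‖)] at hmgf
  rw [← hmgf, ofReal_integral_eq_lintegral_ofReal (.of_integral_ne_zero (by rw [hmgf]; positivity))
    (.of_forall fun _ => (Real.exp_pos _).le)]

theorem lintegral_exp_norm_sq_div_four_stdGaussian :
    ∫⁻ g, ENNReal.ofReal (Real.exp (‖g‖ ^ 2 / 4)) ∂(stdGaussian E)
      = ENNReal.ofReal (√2 ^ Module.finrank ℝ E) := by
  have hnorm : ∀ y : Fin (Module.finrank ℝ E) → ℝ,
      Real.exp (‖∑ i, y i • stdOrthonormalBasis ℝ E i‖ ^ 2 / 4)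
        = ∏ i, Real.exp (y i ^ 2 / 4) := fun y => by
    rw [← real_inner_self_eq_norm_sq, (stdOrthonormalBasis ℝ E).orthonormal.inner_sum,
      ← Real.exp_sum, Finset.sum_div]
    simp only [RCLike.conj_to_real, sq]
  have hint : Integrable (fun x : ℝ => Real.exp (x ^ 2 / 4)) (gaussianReal 0 1) :=
    .of_integral_ne_zero (by rw [integral_exp_sq_div_four_gaussianReal]; positivity)
  rw [stdGaussian, lintegral_map (by fun_prop) (by fun_prop)]
  simp_rw [hnorm]
  rw [← ofReal_integral_eq_lintegral_ofReal (.fintype_prod_dep fun _ => hint)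
    (.of_forall fun _ => by positivity),
    integral_fintype_prod_eq_prod (fun _ x => Real.exp (x ^ 2 / 4))]
  simp [integral_exp_sq_div_four_gaussianReal]

end StandardGaussian

section OrliczNorm

variable {Ω : Type*} [MeasurableSpace Ω] {μ : Measure Ω} {Z : Ω → ℝ} {s : ℝ}

theorem exists_lintegral_exp_sq_le_two (hs : 0 ≤ s) (hZ : psi2Norm μ Z ≤ ENNReal.ofReal s)
    {r : ℝ} (hr : s < r) :
    ∃ t, 0 < t ∧ t < r ∧ ∫⁻ ω, ENNReal.ofReal (Real.exp ((Z ω / t) ^ 2)) ∂μ ≤ 2 := by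
  have hlt : psi2Norm μ Z < ENNReal.ofReal r :=
    hZ.trans_lt ((ENNReal.ofReal_lt_ofReal_iff (hs.trans_lt hr)).mpr hr)
  simp only [psi2Norm, iInf_lt_iff] at hlt
  obtain ⟨t, ⟨ht0, ht⟩, htr⟩ := hlt
  rw [← ENNReal.ofReal_coe_nnreal] at htr
  exact ⟨t, ht0, (ENNReal.ofReal_lt_ofReal_iff_of_nonneg t.2).mp htr, ht⟩

theorem lintegral_exp_le_of_psi2Norm_le (hs : 0 ≤ s) (hZ : psi2Norm μ Z ≤ ENNReal.ofReal s) :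
    ∫⁻ ω, ENNReal.ofReal (Real.exp (Z ω)) ∂μ ≤ 2 * ENNReal.ofReal (Real.exp (s ^ 2 / 4)) := by
  have hbound : ∀ r, s < r →
      ∫⁻ ω, ENNReal.ofReal (Real.exp (Z ω)) ∂μ ≤ 2 * ENNReal.ofReal (Real.exp (r ^ 2 / 4)) := by
    intro r hr
    obtain ⟨t, ht0, htr, ht⟩ := exists_lintegral_exp_sq_le_two hs hZ hr
    have hyoung : ∀ z : ℝ, z ≤ (z / t) ^ 2 + r ^ 2 / 4 := fun z => by
      have hz : z = z / t * t := by field_simp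
      nlinarith [sq_nonneg (z / t - t / 2)]
    calc ∫⁻ ω, ENNReal.ofReal (Real.exp (Z ω)) ∂μ
        ≤ ∫⁻ ω, ENNReal.ofReal (Real.exp ((Z ω / t) ^ 2))
            * ENNReal.ofReal (Real.exp (r ^ 2 / 4)) ∂μ := by
          refine lintegral_mono fun ω => ?_
          rw [← ENNReal.ofReal_mul (Real.exp_pos _).le, ← Real.exp_add]
          exact ENNReal.ofReal_le_ofReal (Real.exp_le_exp.mpr (hyoung _))
      _ ≤ 2 * ENNReal.ofReal (Real.exp (r ^ 2 / 4)) := by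
          rw [lintegral_mul_const' _ _ ENNReal.ofReal_ne_top]
          gcongr
  have hlim : Filter.Tendsto (fun r : ℝ => 2 * ENNReal.ofReal (Real.exp (r ^ 2 / 4)))
      (nhdsWithin s (Set.Ioi s)) (nhds (2 * ENNReal.ofReal (Real.exp (s ^ 2 / 4)))) :=
    (ENNReal.Tendsto.const_mul (ENNReal.tendsto_ofReal (Continuous.tendsto (by fun_prop) s))
      (Or.inr (by simp))).mono_left nhdsWithin_le_nhds
  exact ge_of_tendsto hlim (Filter.eventually_of_mem self_mem_nhdsWithin hbound)

theorem ae_eq_zero_of_psi2Norm_eq_zero (hmeas : AEMeasurable Z μ) (hZ : psi2Norm μ Z = 0) :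
    Z =ᵐ[μ] 0 := by
  have hbound : ∀ r : ℝ, 0 < r →
      ∫⁻ ω, ENNReal.ofReal (Z ω ^ 2) ∂μ ≤ 2 * ENNReal.ofReal (r ^ 2) := by
    intro r hr
    obtain ⟨t, ht0, htr, ht⟩ := exists_lintegral_exp_sq_le_two le_rfl (hZ.le.trans zero_le) hr
    have hexp : ∀ z : ℝ, z ^ 2 ≤ Real.exp ((z / t) ^ 2) * r ^ 2 := fun z => by
      calc z ^ 2 = (z / t) ^ 2 * t ^ 2 := by field_simp
        _ ≤ Real.exp ((z / t) ^ 2) * r ^ 2 := by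
          gcongr
          linarith [Real.add_one_le_exp ((z / t) ^ 2)]
    calc ∫⁻ ω, ENNReal.ofReal (Z ω ^ 2) ∂μ
        ≤ ∫⁻ ω, ENNReal.ofReal (Real.exp ((Z ω / t) ^ 2)) * ENNReal.ofReal (r ^ 2) ∂μ := by
          refine lintegral_mono fun ω => ?_
          rw [← ENNReal.ofReal_mul (Real.exp_pos _).le]
          exact ENNReal.ofReal_le_ofReal (hexp _)
      _ ≤ 2 * ENNReal.ofReal (r ^ 2) := by
          rw [lintegral_mul_const' _ _ ENNReal.ofReal_ne_top]
          gcongr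
  have hlim : Filter.Tendsto (fun r : ℝ => 2 * ENNReal.ofReal (r ^ 2))
      (nhdsWithin 0 (Set.Ioi 0)) (nhds (2 * ENNReal.ofReal (0 ^ 2))) :=
    (ENNReal.Tendsto.const_mul (ENNReal.tendsto_ofReal (Continuous.tendsto (by fun_prop) 0))
      (Or.inr (by simp))).mono_left nhdsWithin_le_nhds
  have hzero : ∫⁻ ω, ENNReal.ofReal (Z ω ^ 2) ∂μ = 0 := by
    simpa using ge_of_tendsto hlim (Filter.eventually_of_mem self_mem_nhdsWithin hbound)
  rw [lintegral_eq_zero_iff' (hmeas.pow_const 2).ennreal_ofReal] at hzero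
  filter_upwards [hzero] with ω hω
  simpa [sq_nonpos_iff] using hω

end OrliczNorm

theorem integrable_sum_and_integral_sum_le {Ω ι : Type*} [MeasurableSpace Ω] {μ : Measure Ω}
    [Fintype ι] {f : ι → Ω → ℝ} {c : ι → ℝ} (hf0 : ∀ k, 0 ≤ f k)
    (hf : ∀ k, AEMeasurable (f k) μ) (hc : ∀ k, 0 ≤ c k)
    (h : ∀ k, ∫⁻ ω, ENNReal.ofReal (f k ω) ∂μ ≤ ENNReal.ofReal (c k)) :
    Integrable (fun ω => ∑ k, f k ω) μ ∧ ∫ ω, ∑ k, f k ω ∂μ ≤ ∑ k, c k := by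
  have hint : ∀ k, Integrable (f k) μ := fun k =>
    (lintegral_ofReal_ne_top_iff_integrable (hf k).aestronglyMeasurable
      (.of_forall (hf0 k))).mp ((h k).trans_lt ENNReal.ofReal_lt_top).ne
  refine ⟨integrable_finsetSum _ fun k _ => hint k, ?_⟩
  rw [integral_finsetSum _ fun k _ => hint k]
  refine Finset.sum_le_sum fun k _ => ?_
  rw [integral_eq_lintegral_of_nonneg_ae (.of_forall (hf0 k)) (hf k).aestronglyMeasurable]
  exact ENNReal.toReal_le_of_le_ofReal (hc k) (h k)

section SubGaussianVectors

open ProbabilityTheory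
open scoped RealInnerProductSpace

variable {Ω F : Type*} [MeasurableSpace Ω] {μ : Measure Ω}
  [NormedAddCommGroup F] [InnerProductSpace ℝ F] [FiniteDimensional ℝ F]
  [MeasurableSpace F] [BorelSpace F] {ξ : Ω → F} {σ : ℝ}

theorem ae_eq_zero_of_psi2Norm_inner_eq_zero (hmeas : AEMeasurable ξ μ)
    (hξ : ∀ v, psi2Norm μ (fun ω => ⟪ξ ω, v⟫) = 0) : ξ =ᵐ[μ] 0 :=
  ae_eq_zero_of_forall_inner (𝕜 := ℝ) fun v => by
    simpa only [real_inner_comm] using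
      ae_eq_zero_of_psi2Norm_eq_zero (hmeas.inner_const (c := v)) (hξ v)

/-- Linearising the square by an independent standard Gaussian vector on `V` reduces the claim to
the exponential moments of the linear forms of `ξ`. -/
theorem lintegral_exp_norm_sq_orthogonalProjectionOnto_le [SFinite μ] (hσ : 0 < σ)
    (hmeas : AEMeasurable ξ μ)
    (hξ : ∀ v, psi2Norm μ (fun ω => ⟪ξ ω, v⟫) ≤ ENNReal.ofReal (σ * ‖v‖)) (V : Submodule ℝ F) :
    ∫⁻ ω, ENNReal.ofReal (Real.exp (‖V.orthogonalProjectionOnto (ξ ω)‖ ^ 2 / (2 * σ ^ 2))) ∂μ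
      ≤ 2 * ENNReal.ofReal (√2 ^ Module.finrank ℝ V) := by
  have hlinear : ∀ x : F,
      ENNReal.ofReal (Real.exp (‖V.orthogonalProjectionOnto x‖ ^ 2 / (2 * σ ^ 2)))
        = ∫⁻ g, ENNReal.ofReal (Real.exp ⟪x, σ⁻¹ • (g : F)⟫) ∂(stdGaussian V) := fun x => by
    simpa [norm_smul, inner_smul_left, inner_smul_right, mul_pow, div_eq_inv_mul, mul_assoc,
      mul_left_comm] using
      (lintegral_exp_inner_stdGaussian (σ⁻¹ • V.orthogonalProjectionOnto x)).symm
  simp_rw [hlinear]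
  rw [lintegral_lintegral_swap]
  · calc ∫⁻ g : V, ∫⁻ ω, ENNReal.ofReal (Real.exp ⟪ξ ω, σ⁻¹ • (g : F)⟫) ∂μ ∂(stdGaussian V)
        ≤ ∫⁻ g : V, 2 * ENNReal.ofReal (Real.exp (‖g‖ ^ 2 / 4)) ∂(stdGaussian V) := by
          refine lintegral_mono fun g => ?_
          have hmgf := lintegral_exp_le_of_psi2Norm_le (by positivity) (hξ (σ⁻¹ • (g : F)))
          rwa [norm_smul, norm_inv, Real.norm_of_nonneg hσ.le, mul_inv_cancel_left₀ hσ.ne'] at hmgf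
      _ = 2 * ENNReal.ofReal (√2 ^ Module.finrank ℝ V) := by
          rw [lintegral_const_mul' _ _ (by simp), lintegral_exp_norm_sq_div_four_stdGaussian]
  · have hpair : AEMeasurable (fun x : Ω × V => ⟪ξ x.1, σ⁻¹ • (x.2 : F)⟫)
        (μ.prod (stdGaussian V)) :=
      hmeas.comp_fst.inner (by fun_prop)
    exact hpair.exp.ennreal_ofReal

omit [MeasurableSpace F] [BorelSpace F] in
theorem sq_inner_le_norm_sq_orthogonalProjectionOnto_mul {V : Submodule ℝ F} {v : F} (hv : v ∈ V)
    (x : F) : ⟪x, v⟫ ^ 2 ≤ ‖V.orthogonalProjectionOnto x‖ ^ 2 * ‖v‖ ^ 2 := by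
  have hinner : ⟪x, v⟫ = ⟪V.orthogonalProjectionOnto x, (⟨v, hv⟩ : V)⟫ :=
    (V.inner_orthogonalProjectionOnto_eq_of_mem_right ⟨v, hv⟩ x).symm
  rw [hinner, ← mul_pow]
  exact sq_le_sq.mpr ((abs_real_inner_le_norm _ _).trans (le_abs_self _))

theorem lintegral_exp_norm_sq_sub_le [SFinite μ] (hσ : 0 < σ) (hmeas : AEMeasurable ξ μ)
    (hξ : ∀ v, psi2Norm μ (fun ω => ⟪ξ ω, v⟫) ≤ ENNReal.ofReal (σ * ‖v‖)) (V : Submodule ℝ F)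
    (w : ℝ) :
    ∫⁻ ω, ENNReal.ofReal (Real.exp
        (‖V.orthogonalProjectionOnto (ξ ω)‖ ^ 2 / (2 * σ ^ 2) - (Module.finrank ℝ V + w))) ∂μ
      ≤ ENNReal.ofReal (2 * Real.exp (-w)) := by
  set d := Module.finrank ℝ V
  have hsqrt : √2 ^ d ≤ Real.exp d := by
    rw [← Real.exp_one_pow]
    gcongr
    exact (Real.sqrt_le_self_iff.mpr (.inr one_le_two)).trans Real.exp_one_gt_two.le
  simp_rw [sub_eq_add_neg, Real.exp_add, ENNReal.ofReal_mul (Real.exp_pos _).le]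
  rw [lintegral_mul_const' _ _ ENNReal.ofReal_ne_top]
  calc (∫⁻ ω, ENNReal.ofReal
          (Real.exp (‖V.orthogonalProjectionOnto (ξ ω)‖ ^ 2 / (2 * σ ^ 2))) ∂μ)
        * ENNReal.ofReal (Real.exp (-(d + w)))
      ≤ 2 * ENNReal.ofReal (√2 ^ d) * ENNReal.ofReal (Real.exp (-(d + w))) := by
        gcongr
        exact lintegral_exp_norm_sq_orthogonalProjectionOnto_le hσ hmeas hξ V
    _ = ENNReal.ofReal (2 * √2 ^ d * Real.exp (-(d + w))) := by
        rw [ENNReal.ofReal_mul (by positivity), ENNReal.ofReal_mul (by positivity)]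
        simp
    _ ≤ ENNReal.ofReal (2 * Real.exp d * Real.exp (-(d + w))) := by gcongr
    _ = ENNReal.ofReal (2 * Real.exp (-w)) := by
        rw [mul_assoc, ← Real.exp_add]
        ring_nf

theorem aemeasurable_of_forall_inner (h : ∀ v, AEMeasurable (fun ω => ⟪ξ ω, v⟫) μ) :
    AEMeasurable ξ μ := by
  have hsum : ξ = fun ω => ∑ i, ⟪ξ ω, stdOrthonormalBasis ℝ F i⟫ • stdOrthonormalBasis ℝ F i := by
    ext ω
    simp_rw [real_inner_comm _ (ξ ω)]
    exact ((stdOrthonormalBasis ℝ F).sum_repr' (ξ ω)).symm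
  rw [hsum]
  exact Finset.aemeasurable_fun_sum _ fun i _ => (h _).smul_const _

omit [MeasurableSpace F] [BorelSpace F] in
/-- A union bound: the weights `w` satisfy Kraft's inequality, so that the excesses of the squared
projections over their levels have summable exponential moments. -/
theorem exists_integrable_sq_inner_le {ι : Type*} [Fintype ι] [SFinite μ] (hσ : 0 ≤ σ)
    (hmeas : ∀ v, AEMeasurable (fun ω => ⟪ξ ω, v⟫) μ)
    (hξ : ∀ v, psi2Norm μ (fun ω => ⟪ξ ω, v⟫) ≤ ENNReal.ofReal (σ * ‖v‖))
    (V : ι → Submodule ℝ F) {w : ι → ℝ} (hkraft : ∑ k, Real.exp (-w k) ≤ 1) :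
    ∃ Z : Ω → ℝ, 0 ≤ Z ∧ Integrable Z μ ∧ ∫ ω, Z ω ∂μ ≤ 2 ∧ ∀ᵐ ω ∂μ, ∀ k, ∀ v ∈ V k,
      ⟪ξ ω, v⟫ ^ 2 ≤ 2 * σ ^ 2 * (Module.finrank ℝ (V k) + w k + Z ω) * ‖v‖ ^ 2 := by
  borelize F
  replace hmeas := aemeasurable_of_forall_inner hmeas
  rcases hσ.eq_or_lt with rfl | hσ
  · refine ⟨0, le_rfl, integrable_zero _ _ _, by simp, ?_⟩
    have hzero := ae_eq_zero_of_psi2Norm_inner_eq_zero hmeas fun v => by simpa using hξ v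
    filter_upwards [hzero] with ω hω k v _
    simp [hω]
  let excess (k : ι) (ω : Ω) : ℝ := Real.exp
    (‖(V k).orthogonalProjectionOnto (ξ ω)‖ ^ 2 / (2 * σ ^ 2) - (Module.finrank ℝ (V k) + w k))
  have hpos : ∀ k, 0 ≤ excess k := fun k ω => (Real.exp_pos _).le
  have hexcess : ∀ k, AEMeasurable (excess k) μ := fun k => by
    have hproj := (V k).orthogonalProjectionOnto.continuous.measurable.comp_aemeasurable hmeas
    exact (((hproj.norm.pow_const 2).div_const _).sub_const _).exp
  obtain ⟨hint, hle⟩ := integrable_sum_and_integral_sum_le hpos hexcess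
    (fun k => mul_nonneg zero_le_two (Real.exp_pos (-w k)).le)
    fun k => lintegral_exp_norm_sq_sub_le hσ hmeas hξ (V k) (w k)
  rw [← Finset.mul_sum] at hle
  refine ⟨fun ω => ∑ k, excess k ω, fun ω => Finset.sum_nonneg fun k _ => hpos k ω, hint,
    by linarith, .of_forall fun ω k v hv => ?_⟩
  have hproj : ‖(V k).orthogonalProjectionOnto (ξ ω)‖ ^ 2
      ≤ 2 * σ ^ 2 * (Module.finrank ℝ (V k) + w k + ∑ k, excess k ω) := by
    have hle := Finset.single_le_sum (f := (excess · ω)) (fun k _ => hpos k ω)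
      (Finset.mem_univ k)
    rw [← div_le_iff₀' (by positivity)]
    linarith [Real.add_one_le_exp (‖(V k).orthogonalProjectionOnto (ξ ω)‖ ^ 2 / (2 * σ ^ 2)
      - (Module.finrank ℝ (V k) + w k))]
  exact (sq_inner_le_norm_sq_orthogonalProjectionOnto_mul hv (ξ ω)).trans (by gcongr)

end SubGaussianVectors

section RowGroups

variable {p m : ℕ} (B : Matrix (Fin p) (Fin m) ℝ)

theorem row_mem_distinctRows (j : Fin p) : B.row j ∈ distinctRows B :=
  Finset.mem_image_of_mem _ (Finset.mem_univ j)

theorem sum_groupSize_mul (φ : (Fin m → ℝ) → ℝ) :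
    ∑ v ∈ distinctRows B, (groupSize B v : ℝ) * φ v = ∑ j, φ (B.row j) := by
  rw [← Finset.sum_fiberwise_of_maps_to fun j _ => row_mem_distinctRows B j]
  refine Finset.sum_congr rfl fun v _ => ?_
  rw [Finset.sum_congr rfl (g := fun _ => φ v) fun j hj => by rw [(Finset.mem_filter.mp hj).2]]
  simp [groupSize]

theorem sum_groupSize : ∑ v ∈ distinctRows B, (groupSize B v : ℝ) = p := by
  simpa using sum_groupSize_mul B fun _ => 1

theorem one_le_groupSize {v : Fin m → ℝ} (hv : v ∈ distinctRows B) : 1 ≤ groupSize B v := by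
  obtain ⟨j, -, rfl⟩ := Finset.mem_image.mp hv
  exact Finset.card_pos.mpr ⟨j, by simp⟩

theorem one_le_numGroups (hp : 0 < p) : 1 ≤ numGroups B :=
  Finset.card_pos.mpr ⟨_, row_mem_distinctRows B ⟨0, hp⟩⟩

theorem numGroups_le : numGroups B ≤ p := by
  simpa [numGroups, distinctRows] using
    (Finset.card_image_le (s := Finset.univ) (f := fun j => B.row j))

theorem rank_le_numGroups : B.rank ≤ numGroups B := by
  have hrange : Set.range B.row = distinctRows B := by simp [distinctRows]
  rw [Matrix.rank_eq_finrank_span_row, hrange]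
  exact finrank_span_finset_le_card _

theorem groupSize_add_numGroups_le {v : Fin m → ℝ} (hv : v ∈ distinctRows B) :
    (groupSize B v : ℝ) + numGroups B ≤ p + 1 := by
  have hsplit := Finset.add_sum_erase (distinctRows B) (fun w => (groupSize B w : ℝ)) hv
  have hothers : (((distinctRows B).erase v).card : ℝ)
      ≤ ∑ w ∈ (distinctRows B).erase v, (groupSize B w : ℝ) := by
    have hnat := Finset.card_nsmul_le_sum ((distinctRows B).erase v) (groupSize B) 1
      fun w hw => one_le_groupSize B (Finset.mem_of_mem_erase hw)
    rw [smul_eq_mul, mul_one] at hnat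
    exact_mod_cast hnat
  have hcard : (((distinctRows B).erase v).card : ℝ) + 1 = numGroups B := by
    exact_mod_cast Finset.card_erase_add_one hv
  rw [sum_groupSize] at hsplit
  linarith

theorem clusterPen_eq_sub :
    clusterPen B = ((p : ℝ) ^ 2 - ∑ v ∈ distinctRows B, (groupSize B v : ℝ) ^ 2) / 2 := by
  have hsum : ∑ v ∈ distinctRows B, (groupSize B v : ℝ) * p = (p : ℝ) ^ 2 := by
    rw [← Finset.sum_mul, sum_groupSize, sq]
  simp only [clusterPen, mul_sub, Finset.sum_sub_distrib, hsum, sq (groupSize B _ : ℝ)]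
  ring

theorem mul_numGroups_sub_one_le_clusterPen :
    (p : ℝ) * ((numGroups B : ℝ) - 1) ≤ 2 * clusterPen B := by
  have hsq : ∑ v ∈ distinctRows B, (groupSize B v : ℝ) ^ 2
      ≤ ∑ v ∈ distinctRows B, (groupSize B v : ℝ) * ((p : ℝ) + 1 - numGroups B) := by
    refine Finset.sum_le_sum fun v hv => ?_
    rw [sq]
    gcongr
    linarith [groupSize_add_numGroups_le B hv]
  rw [← Finset.sum_mul, sum_groupSize] at hsq
  rw [clusterPen_eq_sub]
  linarith

theorem clusterPen_le :
    clusterPen B ≤ ((p : ℝ) ^ 2 - (p : ℝ) ^ 2 / numGroups B) / 2 := by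
  have hcauchy : (p : ℝ) ^ 2
      ≤ numGroups B * ∑ v ∈ distinctRows B, (groupSize B v : ℝ) ^ 2 := by
    simpa only [sum_groupSize, numGroups] using
      sq_sum_le_card_mul_sum_sq (s := distinctRows B) (f := fun v => (groupSize B v : ℝ))
  have hdiv : (p : ℝ) ^ 2 / numGroups B ≤ ∑ v ∈ distinctRows B, (groupSize B v : ℝ) ^ 2 :=
    div_le_of_le_mul₀ (by positivity) (by positivity) (by rwa [mul_comm])
  rw [clusterPen_eq_sub]
  linarith

theorem clusterPen_eq_sum_row_ne :
    clusterPen B = 1 / 2 * ∑ j, ∑ j', if B.row j ≠ B.row j' then (1 : ℝ) else 0 := by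
  rw [clusterPen, sum_groupSize_mul B fun v => (p : ℝ) - groupSize B v]
  congr 1
  refine Finset.sum_congr rfl fun j _ => ?_
  have hcard := Finset.card_filter_add_card_filter_not (s := Finset.univ)
    (fun j' : Fin p => B.row j' = B.row j)
  rw [Finset.card_univ, Fintype.card_fin] at hcard
  rw [Finset.sum_boole, sub_eq_iff_eq_add']
  simp only [groupSize, ne_comm (a := B.row j)]
  exact_mod_cast hcard.symm

theorem pairwisePen_eq_clusterPen : pairwisePen B = clusterPen B := by
  have hsplit : ∑ j, ∑ j', (if B.row j ≠ B.row j' then (1 : ℝ) else 0)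
      = pairwisePen B + ∑ j, ∑ j', if j' < j ∧ B.row j' ≠ B.row j then (1 : ℝ) else 0 := by
    simp only [pairwisePen, ← Finset.sum_add_distrib]
    refine Finset.sum_congr rfl fun j _ => Finset.sum_congr rfl fun j' _ => ?_
    rcases lt_trichotomy j j' with h | rfl | h
    · simp [h, h.not_gt]
    · simp
    · simp [h, h.not_gt, eq_comm (a := B.row j)]
  rw [Finset.sum_comm (f := fun j j' => if j' < j ∧ B.row j' ≠ B.row j then (1 : ℝ) else 0),
    ← pairwisePen, ← two_mul] at hsplit
  rw [clusterPen_eq_sum_row_ne, hsplit]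
  ring

theorem clusterPen_nonneg : 0 ≤ clusterPen B := by
  rw [← pairwisePen_eq_clusterPen, pairwisePen]
  positivity

end RowGroups

section Rates

variable {p m : ℕ} (B : Matrix (Fin p) (Fin m) ℝ)

/-- The rescaled penalty `((m ∨ p) / p) 𝒞(B)`: up to the noise level, the price that the rate of the
estimator pays for the row groups of `B`. -/
def normalizedPen : ℝ := max (m : ℝ) p / p * clusterPen B

theorem normalizedPen_nonneg : 0 ≤ normalizedPen B :=
  mul_nonneg (by positivity) (clusterPen_nonneg B)

theorem lambdaO_sq_mul_clusterPen (σ : ℝ) :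
    lambdaO σ p m ^ 2 * clusterPen B = σ ^ 2 * normalizedPen B := by
  rw [lambdaO, mul_pow, Real.sq_sqrt (by positivity), max_comm, normalizedPen, mul_assoc]

theorem max_mul_numGroups_sub_one_le (hp : 0 < p) :
    max (m : ℝ) p * ((numGroups B : ℝ) - 1) ≤ 2 * normalizedPen B := by
  calc max (m : ℝ) p * ((numGroups B : ℝ) - 1)
      = max (m : ℝ) p / p * (p * ((numGroups B : ℝ) - 1)) := by field_simp
    _ ≤ max (m : ℝ) p / p * (2 * clusterPen B) := by
        gcongr max (m : ℝ) p / p * ?_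
        exact mul_numGroups_sub_one_le_clusterPen B
    _ = 2 * normalizedPen B := by rw [normalizedPen]; ring

theorem normalizedPen_le (hp : 0 < p) :
    normalizedPen B ≤ max (m : ℝ) p * ((p : ℝ) - (p : ℝ) / numGroups B) := by
  have htwice : clusterPen B ≤ (p : ℝ) ^ 2 - (p : ℝ) ^ 2 / numGroups B := by
    linarith [clusterPen_le B, clusterPen_nonneg B]
  calc normalizedPen B
      ≤ max (m : ℝ) p / p * ((p : ℝ) ^ 2 - (p : ℝ) ^ 2 / numGroups B) := by
        rw [normalizedPen]
        gcongr
    _ = max (m : ℝ) p * ((p : ℝ) - (p : ℝ) / numGroups B) := by field_simp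

theorem numGroups_mul_le (hp : 0 < p) : (numGroups B : ℝ) * m ≤ m + 2 * normalizedPen B := by
  have hq : (1 : ℝ) ≤ numGroups B := by exact_mod_cast one_le_numGroups B hp
  have hle : ((numGroups B : ℝ) - 1) * m ≤ ((numGroups B : ℝ) - 1) * max (m : ℝ) p :=
    mul_le_mul_of_nonneg_left (le_max_left _ _) (by linarith)
  linarith [max_mul_numGroups_sub_one_le B hp]

theorem mul_numGroups_sub_one_le (hp : 0 < p) :
    (p : ℝ) * ((numGroups B : ℝ) - 1) ≤ 2 * normalizedPen B := by
  have hq : (1 : ℝ) ≤ numGroups B := by exact_mod_cast one_le_numGroups B hp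
  exact (mul_le_mul_of_nonneg_right (le_max_right _ _) (by linarith)).trans
    (max_mul_numGroups_sub_one_le B hp)

theorem crlComplexity_add_one_le {n : ℕ} (X : Matrix (Fin n) (Fin p) ℝ) (hp : 0 < p) (hm : 0 < m) :
    crlComplexity X B + 1 ≤ 6 * (m + normalizedPen B) := by
  have hm1 : (1 : ℝ) ≤ m := by exact_mod_cast hm
  have hq1 : (1 : ℝ) ≤ numGroups B := by exact_mod_cast one_le_numGroups B hp
  have hlowRank : (min (numGroups B : ℝ) X.rank + m) * B.rank ≤ 2 * (numGroups B * m) := by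
    have hrankq : (B.rank : ℝ) ≤ numGroups B := by exact_mod_cast rank_le_numGroups B
    have hrankm : (B.rank : ℝ) ≤ m := by exact_mod_cast B.rank_le_width
    calc (min (numGroups B : ℝ) X.rank + m) * B.rank
        ≤ numGroups B * B.rank + B.rank * m := by
          rw [add_mul, mul_comm (m : ℝ)]
          gcongr
          exact min_le_left _ _
      _ ≤ numGroups B * m + numGroups B * m := by gcongr
      _ = 2 * (numGroups B * m) := by ring
  have hlabels : ((p : ℝ) - numGroups B) * Real.log (numGroups B)
      ≤ p * ((numGroups B : ℝ) - 1) :=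
    mul_le_mul (by linarith) (Real.log_le_sub_one_of_pos (by linarith)) (Real.log_nonneg hq1)
      (by positivity)
  rw [crlComplexity]
  linarith [numGroups_mul_le B hp, mul_numGroups_sub_one_le B hp]

end Rates

section RowLabellings

variable {n p m : ℕ}

/-- The matrix `M` with `M j a = 1` if the row `j` has the label `a` and `M j a = 0` otherwise, so
that `M * U` has the row `U a` at every `j` with the label `a`. -/
def labelMatrix {q : ℕ} (f : Fin p → Fin q) : Matrix (Fin p) (Fin q) ℝ :=
  (1 : Matrix (Fin q) (Fin q) ℝ).submatrix f id

theorem exists_eq_labelMatrix_mul (B : Matrix (Fin p) (Fin m) ℝ) :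
    ∃ (f : Fin p → Fin (numGroups B)) (U : Matrix (Fin (numGroups B)) (Fin m) ℝ),
      B = labelMatrix f * U := by
  let e : distinctRows B ≃ Fin (numGroups B) := (distinctRows B).equivFin
  refine ⟨fun j => e ⟨B.row j, row_mem_distinctRows B j⟩, Matrix.of fun a => (e.symm a).1, ?_⟩
  ext j k
  simp [labelMatrix, Matrix.mul_apply, Matrix.one_apply, Matrix.row]

/-- The matrices `t • η + X * B`, where the rows of `B` with equal labels are equal. -/
def labelSubspace (X : Matrix (Fin n) (Fin p) ℝ) (η : Matrix (Fin n) (Fin m) ℝ) {q : ℕ}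
    (f : Fin p → Fin q) : Submodule ℝ (Matrix (Fin n) (Fin m) ℝ) :=
  ℝ ∙ η ⊔ LinearMap.range (mulLeftLinearMap (Fin m) ℝ (X * labelMatrix f))

theorem finrank_labelSubspace_le (X : Matrix (Fin n) (Fin p) ℝ) (η : Matrix (Fin n) (Fin m) ℝ)
    {q : ℕ} (f : Fin p → Fin q) :
    Module.finrank ℝ (labelSubspace X η f) ≤ q * m + 1 := by
  have hline : Module.finrank ℝ (ℝ ∙ η) ≤ 1 := by
    simpa using finrank_span_le_card (R := ℝ) {η}
  have hrange := LinearMap.finrank_range_le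
    (mulLeftLinearMap (Fin m) ℝ (X * labelMatrix f))
  rw [Module.finrank_matrix, Module.finrank_self, Fintype.card_fin, Fintype.card_fin] at hrange
  have hsup := Submodule.finrank_add_le_finrank_add_finrank (ℝ ∙ η)
    (LinearMap.range (mulLeftLinearMap (Fin m) ℝ (X * labelMatrix f)))
  rw [labelSubspace]
  linarith

theorem exists_mul_sub_mem_labelSubspace (X : Matrix (Fin n) (Fin p) ℝ)
    (η : Matrix (Fin n) (Fin m) ℝ) (B : Matrix (Fin p) (Fin m) ℝ) :
    ∃ f : Fin p → Fin (numGroups B), X * B - η ∈ labelSubspace X η f := by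
  obtain ⟨f, U, hB⟩ := exists_eq_labelMatrix_mul B
  refine ⟨f, sub_mem (Submodule.mem_sup_right ⟨U, ?_⟩)
    (Submodule.mem_sup_left (Submodule.mem_span_singleton_self η))⟩
  rw [mulLeftLinearMap_apply, Matrix.mul_assoc, ← hB]

/-- The weight of a labelling of `p` rows by `q` labels in the union bound over all labellings: it
dominates the logarithm of their number `q ^ p`, with a margin that is summable over `q`. -/
def labelWeight (p q : ℕ) : ℝ := p * ((q : ℝ) - 1) + q + 1

theorem pow_mul_exp_neg_labelWeight_le (p q : ℕ) :
    (q : ℝ) ^ p * Real.exp (-labelWeight p q) ≤ (1 / 2) ^ (q + 1) := by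
  have hcount : (q : ℝ) ^ p ≤ Real.exp (p * ((q : ℝ) - 1)) := by
    rw [Real.exp_nat_mul]
    gcongr
    linarith [Real.add_one_le_exp ((q : ℝ) - 1)]
  have hhalf : Real.exp (-1) ≤ 1 / 2 := by
    rw [Real.exp_neg, ← one_div]
    exact one_div_le_one_div_of_le two_pos Real.exp_one_gt_two.le
  calc (q : ℝ) ^ p * Real.exp (-labelWeight p q)
      ≤ Real.exp (p * ((q : ℝ) - 1)) * Real.exp (-labelWeight p q) := by gcongr
    _ = Real.exp (-1) ^ (q + 1) := by
        rw [← Real.exp_add, ← Real.exp_nat_mul, labelWeight]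
        push_cast
        ring_nf
    _ ≤ (1 / 2) ^ (q + 1) := by gcongr

theorem sum_exp_neg_labelWeight_le_one (p N : ℕ) :
    ∑ k : Σ q : Fin N, (Fin p → Fin q), Real.exp (-labelWeight p k.1) ≤ 1 := by
  calc ∑ k : Σ q : Fin N, (Fin p → Fin q), Real.exp (-labelWeight p k.1)
      = ∑ q ∈ Finset.range N, (q : ℝ) ^ p * Real.exp (-labelWeight p q) := by
        rw [Fintype.sum_sigma, ← Fin.sum_univ_eq_sum_range
          fun q => (q : ℝ) ^ p * Real.exp (-labelWeight p q)]
        simp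
    _ ≤ ∑ q ∈ Finset.range N, (1 / 2 : ℝ) ^ (q + 1) :=
        Finset.sum_le_sum fun q _ => pow_mul_exp_neg_labelWeight_le p q
    _ ≤ 1 := by
        simp_rw [pow_succ, ← Finset.sum_mul]
        linarith [sum_geometric_two_le N]

theorem finrank_labelSubspace_add_labelWeight_le (X : Matrix (Fin n) (Fin p) ℝ)
    (η : Matrix (Fin n) (Fin m) ℝ) {B : Matrix (Fin p) (Fin m) ℝ} (f : Fin p → Fin (numGroups B))
    (hp : 0 < p) (hm : 0 < m) :
    Module.finrank ℝ (labelSubspace X η f) + labelWeight p (numGroups B)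
      ≤ 4 * m + 6 * normalizedPen B := by
  have hrank : (Module.finrank ℝ (labelSubspace X η f) : ℝ) ≤ numGroups B * m + 1 := by
    exact_mod_cast finrank_labelSubspace_le X η f
  have hm1 : (1 : ℝ) ≤ m := by exact_mod_cast hm
  have hp1 : (1 : ℝ) ≤ p := by exact_mod_cast hp
  have hq1 : (1 : ℝ) ≤ numGroups B := by exact_mod_cast one_le_numGroups B hp
  have hpen := mul_numGroups_sub_one_le B hp
  have hgroups : (numGroups B : ℝ) - 1 ≤ p * ((numGroups B : ℝ) - 1) :=
    le_mul_of_one_le_left (by linarith) hp1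
  rw [labelWeight]
  linarith [numGroups_mul_le B hp]

end RowLabellings

section EffectiveNoise

variable {n p m : ℕ} {Ω : Type*} [MeasurableSpace Ω] {μ : Measure Ω} {σ : ℝ}

/-- The Frobenius inner product, on matrices with the Frobenius norm. -/
abbrev frobInnerProductSpace (n m : ℕ) : InnerProductSpace ℝ (Matrix (Fin n) (Fin m) ℝ) where
  inner := frobInner
  norm_sq_eq_re_inner A := by
    rw [Matrix.frobenius_norm_def, ← Real.sqrt_eq_rpow, Real.sq_sqrt (by positivity)]
    simp [frobInner, sq]
  conj_inner_symm A B := by simp [frobInner, mul_comm]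
  add_left A B C := by simp [frobInner, add_mul, Finset.sum_add_distrib]
  smul_left A B r := by simp [frobInner, Finset.mul_sum, mul_assoc]

theorem aemeasurable_frobInner {A B : Ω → Matrix (Fin n) (Fin m) ℝ}
    (hA : ∀ i j, AEMeasurable (fun ω => A ω i j) μ)
    (hB : ∀ i j, AEMeasurable (fun ω => B ω i j) μ) :
    AEMeasurable (fun ω => frobInner (A ω) (B ω)) μ :=
  Finset.aemeasurable_fun_sum _ fun i _ => Finset.aemeasurable_fun_sum _ fun j _ =>
    (hA i j).mul (hB i j)

attribute [local instance] frobInnerProductSpace in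
/-- Every `X * B - η` lies in the subspace of a labelling with `numGroups B` labels, so that a union
bound over the labellings controls the noise in all these directions at once. -/
theorem exists_integrable_sq_frobInner_le [SFinite μ] (hp : 0 < p) (hm : 0 < m)
    {E : Ω → Matrix (Fin n) (Fin m) ℝ} (hσ : 0 ≤ σ)
    (hmeas : ∀ i j, AEMeasurable (fun ω => E ω i j) μ)
    (hE : ∀ α, psi2Norm μ (fun ω => frobInner (E ω) α) ≤ ENNReal.ofReal (σ * ‖α‖))
    (X : Matrix (Fin n) (Fin p) ℝ) (η : Matrix (Fin n) (Fin m) ℝ) :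
    ∃ Z : Ω → ℝ, 0 ≤ Z ∧ Integrable Z μ ∧ ∫ ω, Z ω ∂μ ≤ 2 ∧
      ∀ᵐ ω ∂μ, ∀ B : Matrix (Fin p) (Fin m) ℝ, frobInner (E ω) (X * B - η) ^ 2
        ≤ 2 * σ ^ 2 * (4 * m + 6 * normalizedPen B + Z ω) * ‖X * B - η‖ ^ 2 := by
  obtain ⟨Z, hZ0, hZint, hZ2, hZ⟩ := exists_integrable_sq_inner_le (ξ := E) hσ
    (fun _ => aemeasurable_frobInner hmeas fun _ _ => aemeasurable_const) hE
    (fun k : Σ q : Fin (p + 1), (Fin p → Fin q) => labelSubspace X η k.2)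
    (sum_exp_neg_labelWeight_le_one p (p + 1))
  refine ⟨Z, hZ0, hZint, hZ2, ?_⟩
  filter_upwards [hZ] with ω hω B
  obtain ⟨f, hf⟩ := exists_mul_sub_mem_labelSubspace X η B
  refine (hω ⟨⟨numGroups B, Nat.lt_succ_of_le (numGroups_le B)⟩, f⟩ _ hf).trans ?_
  gcongr _ * (?_ + _) * _
  exact finrank_labelSubspace_add_labelWeight_le X η f hp hm

end EffectiveNoise

section PredictionError

variable {n p m : ℕ}

theorem sq_norm_eq_frobInner_self (A : Matrix (Fin n) (Fin m) ℝ) : ‖A‖ ^ 2 = frobInner A A :=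
  (frobInnerProductSpace n m).norm_sq_eq_re_inner A

theorem bregman_eq_add_frobInner_neg (ψ : Matrix (Fin n) (Fin m) ℝ → ℝ)
    (α β : Matrix (Fin n) (Fin m) ℝ) :
    bregman ψ α β = ψ α - ψ β + frobInner (-matGrad ψ β) (α - β) := by
  simp [bregman, frobInner, sub_eq_add_neg]

theorem basic_inequality {l : Matrix (Fin n) (Fin m) ℝ → ℝ} {X : Matrix (Fin n) (Fin p) ℝ}
    {B Bstar : Matrix (Fin p) (Fin m) ℝ} {E : Matrix (Fin n) (Fin m) ℝ} {δ κ lam : ℝ}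
    (hcurv : δ * D2 (X * B) (X * Bstar) ≤ l (X * B) - l (X * Bstar)
      + frobInner E (X * B - X * Bstar) + κ * clusterPen B + κ * clusterPen Bstar)
    (hopt : pairwiseObjective l X lam B ≤ pairwiseObjective l X lam Bstar) :
    δ / 2 * ‖X * B - X * Bstar‖ ^ 2 ≤ frobInner E (X * B - X * Bstar)
      + lam ^ 2 / 2 * (clusterPen Bstar - clusterPen B)
      + κ * (clusterPen B + clusterPen Bstar) := by
  simp only [D2, pairwiseObjective, pairwisePen_eq_clusterPen] at hcurv hopt
  linarith

theorem le_quarter_mul_sq_add_of_sq_le {a b x δ : ℝ} (hδ : 0 < δ) (hb : 0 ≤ b)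
    (h : a ^ 2 ≤ b * x ^ 2) : a ≤ δ / 4 * x ^ 2 + b / δ := by
  have hsq : (δ / 4 * x ^ 2 + b / δ) ^ 2 = b * x ^ 2 + (δ / 4 * x ^ 2 - b / δ) ^ 2 := by
    field_simp
    ring
  have hamgm : b * x ^ 2 ≤ (δ / 4 * x ^ 2 + b / δ) ^ 2 := by
    linarith [sq_nonneg (δ / 4 * x ^ 2 - b / δ)]
  exact le_of_sq_le_sq (h.trans hamgm) (by positivity)

/-- With `M = K ∨ 1/δ`, the penalty `A² M σ² P / 2` at the estimator absorbs both the noise term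
`12 M σ² P` and the curvature term `K σ² P` as soon as `26 ≤ A²`. -/
theorem sq_error_le {x a m Z P Pstar σ δ K A : ℝ} (hδ : 0 < δ) (hA : 6 ≤ A)
    (hm : 0 ≤ m) (hP : 0 ≤ P) (hPstar : 0 ≤ Pstar) (hZ : 0 ≤ Z)
    (ha : a ^ 2 ≤ 2 * σ ^ 2 * (4 * m + 6 * P + Z) * x ^ 2)
    (hbasic : δ / 2 * x ^ 2 ≤ a + A ^ 2 * max K (1 / δ) * σ ^ 2 / 2 * (Pstar - P)
      + K * σ ^ 2 * (P + Pstar)) :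
    x ^ 2 ≤ max (K * δ) 1 * σ ^ 2 / δ ^ 2
      * (32 * m + (2 * A ^ 2 + 4) * Pstar + 8 * Z) := by
  set M := max K (1 / δ) with hM
  have hKM : K ≤ M := le_max_left _ _
  have hδM : 1 / δ ≤ M := le_max_right _ _
  have hrate : max (K * δ) 1 * σ ^ 2 / δ ^ 2 = M * σ ^ 2 / δ := by
    have hmul : max (K * δ) 1 = M * δ := by
      rw [hM, max_mul_of_nonneg _ _ hδ.le, one_div_mul_cancel hδ.ne']
    rw [hmul]
    field_simp
  have hnoise : a ≤ δ / 4 * x ^ 2 + 2 * (M * σ ^ 2) * (4 * m + 6 * P + Z) := by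
    calc a ≤ δ / 4 * x ^ 2 + 2 * σ ^ 2 * (4 * m + 6 * P + Z) / δ :=
          le_quarter_mul_sq_add_of_sq_le hδ (by positivity) ha
      _ = δ / 4 * x ^ 2 + 2 * (1 / δ * σ ^ 2) * (4 * m + 6 * P + Z) := by ring
      _ ≤ δ / 4 * x ^ 2 + 2 * (M * σ ^ 2) * (4 * m + 6 * P + Z) := by gcongr
  have hcurv : K * σ ^ 2 * (P + Pstar) ≤ M * σ ^ 2 * (P + Pstar) := by gcongr
  have habsorb : 26 * (M * σ ^ 2 * P) ≤ A ^ 2 * (M * σ ^ 2 * P) := by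
    gcongr
    nlinarith
  rw [hrate, div_mul_eq_mul_div, le_div_iff₀ hδ]
  linarith

variable {Ω : Type*} [MeasurableSpace Ω] {μ : Measure Ω}

theorem aemeasurable_sq_norm_sub {A : Ω → Matrix (Fin n) (Fin m) ℝ}
    (hA : ∀ i j, AEMeasurable (fun ω => A ω i j) μ) (η : Matrix (Fin n) (Fin m) ℝ) :
    AEMeasurable (fun ω => ‖A ω - η‖ ^ 2) μ := by
  simp_rw [sq_norm_eq_frobInner_self]
  have hsub : ∀ i j, AEMeasurable (fun ω => (A ω - η) i j) μ := fun i j => (hA i j).sub_const _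
  exact aemeasurable_frobInner hsub hsub

theorem integrable_and_integral_le_of_ae_le [IsProbabilityMeasure μ] {f Z : Ω → ℝ} {r a b : ℝ}
    (hf : AEMeasurable f μ) (hf0 : 0 ≤ f) (hZ : Integrable Z μ)
    (h : ∀ᵐ ω ∂μ, f ω ≤ r * (a + b * Z ω)) :
    Integrable f μ ∧ ∫ ω, f ω ∂μ ≤ r * (a + b * ∫ ω, Z ω ∂μ) := by
  have hbZ : Integrable (fun ω => b * Z ω) μ := hZ.const_mul b
  have hmaj : Integrable (fun ω => r * (a + b * Z ω)) μ :=
    ((integrable_const a).add hbZ).const_mul r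
  refine ⟨hmaj.mono' hf.aestronglyMeasurable ?_, ?_⟩
  · simpa only [Real.norm_of_nonneg (hf0 _)] using h
  · refine (integral_mono_of_nonneg (.of_forall hf0) hmaj h).trans_eq ?_
    rw [integral_const_mul, integral_add (integrable_const a) hbZ, integral_const_mul]
    simp

theorem exists_integrable_sq_error_le [SFinite μ] (hp : 0 < p) (hm : 0 < m)
    {l : Ω → Matrix (Fin n) (Fin m) ℝ → ℝ} {E : Ω → Matrix (Fin n) (Fin m) ℝ}
    {X : Matrix (Fin n) (Fin p) ℝ} {Bstar : Matrix (Fin p) (Fin m) ℝ} {σ δ K A : ℝ}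
    (hσ : 0 ≤ σ) (hδ : 0 < δ) (hK : 0 ≤ K) (hA : 6 ≤ A)
    (hmeas : ∀ i j, AEMeasurable (fun ω => E ω i j) μ)
    (hE : ∀ α, psi2Norm μ (fun ω => frobInner (E ω) α) ≤ ENNReal.ofReal (σ * ‖α‖))
    {Bhat : Ω → Matrix (Fin p) (Fin m) ℝ}
    (hcurv : ∀ᵐ ω ∂μ, δ * D2 (X * Bhat ω) (X * Bstar) ≤ l ω (X * Bhat ω) - l ω (X * Bstar)
      + frobInner (E ω) (X * Bhat ω - X * Bstar)
      + K * lambdaO σ p m ^ 2 * clusterPen (Bhat ω) + K * lambdaO σ p m ^ 2 * clusterPen Bstar)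
    (hopt : ∀ᵐ ω ∂μ,
      pairwiseObjective (l ω) X (A * √(max K (1 / δ)) * lambdaO σ p m) (Bhat ω)
        ≤ pairwiseObjective (l ω) X (A * √(max K (1 / δ)) * lambdaO σ p m) Bstar) :
    ∃ Z : Ω → ℝ, Integrable Z μ ∧ ∫ ω, Z ω ∂μ ≤ 2 ∧
      ∀ᵐ ω ∂μ, ‖X * Bhat ω - X * Bstar‖ ^ 2 ≤ max (K * δ) 1 * σ ^ 2 / δ ^ 2
        * (32 * m + (2 * A ^ 2 + 4) * normalizedPen Bstar + 8 * Z ω) := by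
  obtain ⟨Z, hZ0, hZint, hZ2, hnoise⟩ :=
    exists_integrable_sq_frobInner_le hp hm hσ hmeas hE X (X * Bstar)
  refine ⟨Z, hZint, hZ2, ?_⟩
  have hlam : (A * √(max K (1 / δ)) * lambdaO σ p m) ^ 2
      = A ^ 2 * max K (1 / δ) * lambdaO σ p m ^ 2 := by
    rw [mul_pow, mul_pow, Real.sq_sqrt (le_max_of_le_left hK)]
  filter_upwards [hcurv, hopt, hnoise] with ω hcurv hopt hnoise
  refine sq_error_le hδ hA (Nat.cast_nonneg m) (normalizedPen_nonneg (Bhat ω))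
    (normalizedPen_nonneg Bstar) (hZ0 ω) (hnoise (Bhat ω)) ?_
  have hbasic := basic_inequality hcurv hopt
  have hpen := lambdaO_sq_mul_clusterPen (Bhat ω) σ
  have hpenstar := lambdaO_sq_mul_clusterPen Bstar σ
  rw [hlam] at hbasic
  linear_combination hbasic + (K - A ^ 2 * max K (1 / δ) / 2) * hpen
    + (K + A ^ 2 * max K (1 / δ) / 2) * hpenstar

end PredictionError

end PairwiseL0

end

open PairwiseL0 in
/-- For a differentiable loss, `E` is the effective noise `-∇l₀(XB*; Y)`; in general it may be the
negative of a subgradient or of any other substitute for which the curvature condition holds. -/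
theorem theoremA3_general {n p m : ℕ} (hp : 0 < p) (hm : 0 < m)
    {Ω : Type*} [MeasurableSpace Ω] {μ : Measure Ω} [IsProbabilityMeasure μ]
    {X : Matrix (Fin n) (Fin p) ℝ} {l : Ω → Matrix (Fin n) (Fin m) ℝ → ℝ}
    {Bstar : Matrix (Fin p) (Fin m) ℝ} {σ δ K A : ℝ}
    (hσ : 0 ≤ σ) (hδ : 0 < δ) (hK : 0 ≤ K) (hA : 6 ≤ A)
    {E : Ω → Matrix (Fin n) (Fin m) ℝ} (hmeas : ∀ i j, AEMeasurable (fun ω => E ω i j) μ)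
    (hE : ∀ α, psi2Norm μ (fun ω => frobInner (E ω) α) ≤ ENNReal.ofReal (σ * ‖α‖))
    {Bhat : Ω → Matrix (Fin p) (Fin m) ℝ}
    (hBhat : ∀ i j, AEMeasurable (fun ω => (X * Bhat ω) i j) μ)
    (hcurv : ∀ᵐ ω ∂μ, δ * D2 (X * Bhat ω) (X * Bstar) ≤ l ω (X * Bhat ω) - l ω (X * Bstar)
      + frobInner (E ω) (X * Bhat ω - X * Bstar)
      + K * lambdaO σ p m ^ 2 * clusterPen (Bhat ω) + K * lambdaO σ p m ^ 2 * clusterPen Bstar)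
    (hopt : ∀ᵐ ω ∂μ,
      pairwiseObjective (l ω) X (A * √(max K (1 / δ)) * lambdaO σ p m) (Bhat ω)
        ≤ pairwiseObjective (l ω) X (A * √(max K (1 / δ)) * lambdaO σ p m) Bstar) :
    Integrable (fun ω => ‖X * Bhat ω - X * Bstar‖ ^ 2) μ ∧
    ∫ ω, ‖X * Bhat ω - X * Bstar‖ ^ 2 ∂μ ≤
      (2 * A ^ 2 + 4) * (max (K * δ) 1 * σ ^ 2 / δ ^ 2 *
        ((m : ℝ) + max (m : ℝ) p / p * clusterPen Bstar)) ∧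
    max (K * δ) 1 * σ ^ 2 / δ ^ 2 * ((m : ℝ) + max (m : ℝ) p / p * clusterPen Bstar) ≤
      max (K * δ) 1 * σ ^ 2 / δ ^ 2 *
        ((m : ℝ) + max (m : ℝ) p * ((p : ℝ) - (p : ℝ) / numGroups Bstar)) ∧
    max (K * δ) 1 * σ ^ 2 / δ ^ 2 * (crlComplexity X Bstar + 1) ≤
      (2 * A ^ 2 + 4) * (max (K * δ) 1 * σ ^ 2 / δ ^ 2 *
        ((m : ℝ) + max (m : ℝ) p / p * clusterPen Bstar)) := by
  have hPdef : max (m : ℝ) p / p * clusterPen Bstar = normalizedPen Bstar := rfl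
  rw [hPdef, mul_left_comm (2 * A ^ 2 + 4)]
  have hP := normalizedPen_nonneg Bstar
  have hm1 : (1 : ℝ) ≤ m := by exact_mod_cast hm
  have hc : 48 ≤ 2 * A ^ 2 + 4 := by nlinarith
  obtain ⟨Z, hZ, hZ2, herror⟩ :=
    exists_integrable_sq_error_le hp hm hσ hδ hK hA hmeas hE hcurv hopt
  obtain ⟨hint, hle⟩ := integrable_and_integral_le_of_ae_le
    (aemeasurable_sq_norm_sub hBhat (X * Bstar)) (fun _ => sq_nonneg _) hZ herror
  refine ⟨hint, hle.trans ?_, ?_, ?_⟩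
  · gcongr
    nlinarith
  · gcongr
    exact normalizedPen_le Bstar hp
  · gcongr
    exact (crlComplexity_add_one_le Bstar X hp hm).trans (by gcongr; linarith)

open PairwiseL0 in
theorem theoremA3 :
    ∃ A₀ : ℝ, 0 < A₀ ∧ ∀ A : ℝ, A₀ ≤ A → ∃ c : ℝ, 0 < c ∧
      ∀ (n p m : ℕ) (_ : 0 < p) (_ : 0 < m)
        (Ω : Type*) [MeasurableSpace Ω] (μ : Measure Ω) [IsProbabilityMeasure μ]
        (X : Matrix (Fin n) (Fin p) ℝ)
        (Y : Ω → Matrix (Fin n) (Fin m) ℝ)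
        -- the loss `l₀ η y`, a function of the systematic component `η` and the response `y`
        (l₀ : Matrix (Fin n) (Fin m) ℝ → Matrix (Fin n) (Fin m) ℝ → ℝ)
        (_ : ∀ y, Differentiable ℝ fun η => l₀ η y)
        (Bstar : Matrix (Fin p) (Fin m) ℝ)
        (σ δ K : ℝ) (_ : 0 ≤ σ) (_ : 0 < δ) (_ : 0 ≤ K)
        -- the effective noise `-∇l₀(XB*; Y)`
        (_ : IsSubGaussianNoise μ (fun ω => -matGrad (fun η => l₀ η (Y ω)) (X * Bstar)) σ)
        -- the curvature condition
        (_ : ∀ᵐ ω ∂μ, ∀ B₁ B₂ : Matrix (Fin p) (Fin m) ℝ,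
          δ * D2 (X * B₁) (X * B₂) ≤
            bregman (fun η => l₀ η (Y ω)) (X * B₁) (X * B₂)
              + K * lambdaO σ p m ^ 2 * clusterPen B₁ + K * lambdaO σ p m ^ 2 * clusterPen B₂)
        -- the estimator, an optimal solution of the penalized problem
        (Bhat : Ω → Matrix (Fin p) (Fin m) ℝ)
        (_ : ∀ i j, AEMeasurable (fun ω => (X * Bhat ω) i j) μ)
        (_ : ∀ᵐ ω ∂μ, ∀ B : Matrix (Fin p) (Fin m) ℝ,
          pairwiseObjective (fun η => l₀ η (Y ω)) X
              (A * Real.sqrt (max K (1 / δ)) * lambdaO σ p m) (Bhat ω)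
            ≤ pairwiseObjective (fun η => l₀ η (Y ω)) X
              (A * Real.sqrt (max K (1 / δ)) * lambdaO σ p m) B),
        Integrable (fun ω => ‖X * Bhat ω - X * Bstar‖ ^ 2) μ ∧
        ∫ ω, ‖X * Bhat ω - X * Bstar‖ ^ 2 ∂μ ≤
          c * (max (K * δ) 1 * σ ^ 2 / δ ^ 2 *
            ((m : ℝ) + max (m : ℝ) p / p * clusterPen Bstar)) ∧
        max (K * δ) 1 * σ ^ 2 / δ ^ 2 * ((m : ℝ) + max (m : ℝ) p / p * clusterPen Bstar) ≤
          max (K * δ) 1 * σ ^ 2 / δ ^ 2 *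
            ((m : ℝ) + max (m : ℝ) p * ((p : ℝ) - (p : ℝ) / numGroups Bstar)) ∧
        -- the rate of clustered reduced-rank learning is never larger, up to the constant
        max (K * δ) 1 * σ ^ 2 / δ ^ 2 * (crlComplexity X Bstar + 1) ≤
          c * (max (K * δ) 1 * σ ^ 2 / δ ^ 2 *
            ((m : ℝ) + max (m : ℝ) p / p * clusterPen Bstar)) := by
  refine ⟨6, by norm_num, fun A hA => ⟨2 * A ^ 2 + 4, by positivity, ?_⟩⟩
  intro n p m hp hm Ω _ μ _ X Y l₀ _ Bstar σ δ K hσ hδ hK hE hcurv Bhat hBhat hopt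
  refine theoremA3_general hp hm hσ hδ hK hA hE.aemeasurable hE.psi2_le hBhat ?_
    (hopt.mono fun ω h => h Bstar)
  exact hcurv.mono fun ω h => by
    simpa only [bregman_eq_add_frobInner_neg] using h (Bhat ω) Bstar
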